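/- Let $M$ be a smooth manifold (Hausdorff, second countable, finite-dimensional, without boundary; for example a symplectic manifold). Let $\mathcal{Z}=C^\infty(M)[[\hbar]]$ be the ring of formal power series in $\hbar$ whose coefficients are complex valued smooth functions on $M$; when $M$ is symplectic this is the centre of the algebra of sections of its Weyl bundle. Let $\Omega^1(M)[[\hbar]]$ be the group of formal power series with coefficients in the complex valued smooth one-forms on $M$, let $Z^1(M)[[\hbar]]$ be the subgroup of those with closed coefficients, and extend $d$ coefficientwise to $d\colon\mathcal{Z}\to\Omega^1(M)[[\hbar]]$. Let $d\mathcal{Z}=\{dg : g\in\mathcal{Z}\}$ be the subgroup of exact elements, and let $$D\colon \mathcal{Z}^\times\to \Omega^1(M)[[\hbar]],\qquad D(f)=f^{-1}\,df,$$ which is a homomorphism from the multiplicative group of invertible elements of $\mathcal{Z}$ to the additive group $\Omega^1(M)[[\hbar]]$. (For a Fedosov connection $\nabla$, this is the restriction to $\mathcal{Z}^\times$ of the map $\mathbb{D}\colon g\mapsto g^{-1}\nabla g$.) Then $D$ takes values in $Z^1(M)[[\hbar]]$, $$d\mathcal{Z}\subset \operatorname{Im} D,$$ and there is an isomorphism of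 abelian groups $$\operatorname{Im} D/d\mathcal{Z}\;\simeq\; H^1(M,\mathbb{Z}),$$ where $H^1(M,\mathbb{Z})$ is the first singular cohomology group of $M$ with integer coefficients. -/

import Mathlib

open scoped Manifold ContDiff Bundle

noncomputable section

/-- Multiplication of complex numbers is smooth over the reals, so that complex valued smooth
functions on a real manifold form a ring. -/
instance complexContMDiffRing : ContMDiffRing 𝓘(ℝ, ℂ) ∞ ℂ :=
  { (inferInstance : LieAddGroup 𝓘(ℝ, ℂ) ∞ ℂ) with
    contMDiff_mul := by
      rw [contMDiff_iff]
      refine ⟨continuous_mul, fun x y => ?_⟩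
      simp only [mfld_simps, chartAt_self_eq]
      rw [contDiffOn_univ]
      exact contDiff_mul }

section Forms

variable (n : ℕ) (M : Type*) [TopologicalSpace M] [ChartedSpace (EuclideanSpace ℝ (Fin n)) M]

/-- The ring `C^∞(M)` of complex valued smooth functions on the real manifold `M`. -/
abbrev SmoothFun : Type _ := C^∞⟮𝓡 n, M; 𝓘(ℝ, ℂ), ℂ⟯

instance : CommRing (SmoothFun n M) := inferInstance

variable [IsManifold (𝓡 n) ∞ M]

/-- The space `Ω¹(M)` of complex valued smooth differential one-forms on `M`, that is, smooth
sections of the bundle with fibre `Hom_ℝ(T_x M, ℂ)`. -/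
abbrev OneForm : Type _ :=
  Cₛ^∞⟮𝓡 n; EuclideanSpace ℝ (Fin n) →L[ℝ] ℂ,
    fun x : M => TangentSpace (𝓡 n) x →L[ℝ] Bundle.Trivial M ℂ x⟯

instance : AddCommGroup (OneForm n M) := inferInstance

variable {n M}

/-- The value at `x` of a one-form. -/
def OneForm.val (α : OneForm n M) (x : M) : TangentSpace (𝓡 n) x →L[ℝ] ℂ := α x

theorem OneForm.ext_val {α β : OneForm n M} (h : ∀ x, α.val x = β.val x) : α = β :=
  ContMDiffSection.ext h

theorem OneForm.inCoordinates_eq (x₀ x : M)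
    (φ : TangentSpace (𝓡 n) x →L[ℝ] Bundle.Trivial M ℂ x) :
    ContinuousLinearMap.inCoordinates (EuclideanSpace ℝ (Fin n))
      (TangentSpace (𝓡 n) : M → Type _) ℂ (Bundle.Trivial M ℂ) x₀ x x₀ x φ =
    (show TangentSpace (𝓡 n) x →L[ℝ] ℂ from φ) ∘L
      (trivializationAt (EuclideanSpace ℝ (Fin n)) (TangentSpace (𝓡 n)) x₀).symmL ℝ x := by
  ext v
  simp [ContinuousLinearMap.inCoordinates]

/-- The smooth one-form `x ↦ f x • α x`. -/
instance : SMul (SmoothFun n M) (OneForm n M) where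
  smul f α := ⟨fun x => f x • α.val x, by
    intro x
    have h := α.contMDiff x
    rw [contMDiffAt_hom_bundle] at h ⊢
    refine ⟨contMDiffAt_id, ?_⟩
    have h2 := h.2
    simp only [OneForm.inCoordinates_eq] at h2 ⊢
    have hb : ContDiff ℝ ∞ (fun p : ℂ × (EuclideanSpace ℝ (Fin n) →L[ℝ] ℂ) => p.1 • p.2) :=
      isBoundedBilinearMap_smul.contDiff
    exact hb.contMDiff.contMDiffAt.comp x ((f.contMDiff x).prodMk_space h2)⟩

/-- The one-forms are a module over the ring of smooth functions. -/
instance : Module (SmoothFun n M) (OneForm n M) where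
  one_smul α := OneForm.ext_val fun x => one_smul ℂ (α.val x)
  mul_smul f g α := OneForm.ext_val fun x => mul_smul (f x) (g x) (α.val x)
  smul_zero f := OneForm.ext_val fun x => smul_zero (A := TangentSpace (𝓡 n) x →L[ℝ] ℂ) (f x)
  smul_add f α β := OneForm.ext_val fun x => smul_add (f x) (α.val x) (β.val x)
  add_smul f g α := OneForm.ext_val fun x => add_smul (f x) (g x) (α.val x)
  zero_smul α := OneForm.ext_val fun x => zero_smul ℂ (α.val x)

/-- The differential `d : C^∞(M) → Ω¹(M)`. -/
def dFun : SmoothFun n M →+ OneForm n M where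
  toFun f := ⟨fun x => mvfderiv (𝓡 n) f x, by
    intro x
    rw [contMDiffAt_hom_bundle]
    refine ⟨contMDiffAt_id, ?_⟩
    have h := (f.contMDiff x).mfderiv_const (m := ∞) (by simp)
    refine h.congr_of_eventuallyEq (Filter.Eventually.of_forall fun y => ?_)
    simp only [OneForm.inCoordinates_eq]
    ext v
    simp [inTangentCoordinates, ContinuousLinearMap.inCoordinates, mvfderiv]
    rfl⟩
  map_zero' := OneForm.ext_val fun x => mvfderiv_zero
  map_add' f g := OneForm.ext_val fun x =>
    mvfderiv_add (f.contMDiff.mdifferentiable (by simp) x)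
      (g.contMDiff.mdifferentiable (by simp) x)

theorem dFun_mul (f g : SmoothFun n M) : dFun (f * g) = f • dFun g + g • dFun f := by
  refine OneForm.ext_val fun x => ?_
  exact ((f.contMDiff.mdifferentiable (by simp) x).hasMFDerivAt.mul
    (g.contMDiff.mdifferentiable (by simp) x).hasMFDerivAt).mfderiv

/-- The one-form `α` on the domain of the chart around `p`, pulled back to the model space. -/
def OneForm.inChart (α : OneForm n M) (p : M) (y : EuclideanSpace ℝ (Fin n)) :
    EuclideanSpace ℝ (Fin n) →L[ℝ] ℂ :=
  α.val ((extChartAt (𝓡 n) p).symm y) ∘L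
    mfderiv 𝓘(ℝ, EuclideanSpace ℝ (Fin n)) (𝓡 n) (extChartAt (𝓡 n) p).symm y

/-- `α` is closed: its exterior derivative vanishes, as computed in charts. -/
def OneForm.IsClosed (α : OneForm n M) : Prop :=
  ∀ p : M, ∀ y ∈ (extChartAt (𝓡 n) p).target,
    extDeriv (fun z => ContinuousAlternatingMap.ofSubsingleton ℝ (EuclideanSpace ℝ (Fin n)) ℂ
      (0 : Fin 1) (α.inChart p z)) y = 0

end Forms

section FormalSeries

/-- Formal power series `W[[ħ]]` with coefficients in `W`, given by their coefficients. -/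
@[ext]
structure FormalSeries (W : Type*) where
  /-- The coefficient of `ħ^k`. -/
  coeff : ℕ → W

namespace FormalSeries

variable {A W : Type*} [CommRing A] [AddCommGroup W] [Module A W]

instance : Zero (FormalSeries W) := ⟨⟨fun _ => 0⟩⟩
instance : Add (FormalSeries W) := ⟨fun α β => ⟨fun k => α.coeff k + β.coeff k⟩⟩
instance : Neg (FormalSeries W) := ⟨fun α => ⟨fun k => -α.coeff k⟩⟩

@[simp] theorem coeff_zero (k : ℕ) : (0 : FormalSeries W).coeff k = 0 := rfl
@[simp] theorem coeff_add (α β : FormalSeries W) (k : ℕ) :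
    (α + β).coeff k = α.coeff k + β.coeff k := rfl
@[simp] theorem coeff_neg (α : FormalSeries W) (k : ℕ) : (-α).coeff k = -α.coeff k := rfl

instance : AddCommGroup (FormalSeries W) where
  add_assoc α β γ := FormalSeries.ext (funext fun k => add_assoc _ _ _)
  zero_add α := FormalSeries.ext (funext fun k => zero_add _)
  add_zero α := FormalSeries.ext (funext fun k => add_zero _)
  add_comm α β := FormalSeries.ext (funext fun k => add_comm _ _)
  neg_add_cancel α := FormalSeries.ext (funext fun k => neg_add_cancel _)
  nsmul := nsmulRec
  zsmul := zsmulRec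

/-- The product `f β` of formal power series: `(f β)_k = ∑_{i + j = k} f_i β_j`. -/
instance : SMul (PowerSeries A) (FormalSeries W) where
  smul f β :=
    ⟨fun k => ∑ p ∈ Finset.HasAntidiagonal.antidiagonal k, PowerSeries.coeff p.1 f • β.coeff p.2⟩

theorem coeff_smul (f : PowerSeries A) (β : FormalSeries W) (k : ℕ) :
    (f • β).coeff k =
      ∑ p ∈ Finset.HasAntidiagonal.antidiagonal k, PowerSeries.coeff p.1 f • β.coeff p.2 := rfl

/-- `W[[ħ]]` is a module over `A[[ħ]]` if `W` is a module over `A`. -/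
instance : Module (PowerSeries A) (FormalSeries W) where
  one_smul β := by
    ext k
    rw [coeff_smul, Finset.sum_eq_single (0, k)]
    · simp
    · rintro ⟨i, j⟩ hij hne
      have hi : i ≠ 0 := by
        rintro rfl
        apply hne
        simpa using hij
      simp [PowerSeries.coeff_one, hi]
    · simp
  mul_smul f g β := by
    ext k
    simp only [coeff_smul, PowerSeries.coeff_mul, Finset.sum_smul, Finset.smul_sum, mul_smul]
    rw [Finset.sum_sigma', Finset.sum_sigma']
    refine Finset.sum_nbij' (fun ⟨⟨_, j⟩, ⟨k, l⟩⟩ => ⟨(k, l + j), (l, j)⟩)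
      (fun ⟨⟨i, _⟩, ⟨k, l⟩⟩ => ⟨(i + k, l), (i, k)⟩) ?_ ?_ ?_ ?_ ?_ <;>
    simp only [Finset.mem_sigma, Finset.HasAntidiagonal.mem_antidiagonal] <;> grind
  smul_zero f := by
    ext k
    simp [coeff_smul]
  smul_add f α β := by
    ext k
    simp [coeff_smul, Finset.sum_add_distrib]
  add_smul f g β := by
    ext k
    simp [coeff_smul, Finset.sum_add_distrib, add_smul]
  zero_smul β := by
    ext k
    simp [coeff_smul]

end FormalSeries

end FormalSeries

section FormalForms

variable (n : ℕ) (M : Type*) [TopologicalSpace M] [ChartedSpace (EuclideanSpace ℝ (Fin n)) M]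

/-- The ring `𝒵 = C^∞(M)[[ħ]]`. -/
abbrev FormalFun : Type _ := PowerSeries (SmoothFun n M)

variable [IsManifold (𝓡 n) ∞ M]

/-- Formal power series `Ω¹(M)[[ħ]]` with coefficients in the one-forms. -/
abbrev FormalOneForm : Type _ := FormalSeries (OneForm n M)

instance : Module (FormalFun n M) (FormalOneForm n M) := inferInstance

variable {n M}

/-- The differential `d : C^∞(M)[[ħ]] → Ω¹(M)[[ħ]]`, taken coefficient by coefficient. -/
def formalD : FormalFun n M →+ FormalOneForm n M where
  toFun f := ⟨fun k => dFun (PowerSeries.coeff k f)⟩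
  map_zero' := by
    ext1
    funext k
    change dFun (PowerSeries.coeff k (0 : FormalFun n M)) = 0
    rw [map_zero, map_zero]
  map_add' f g := by
    ext1
    funext k
    change dFun (PowerSeries.coeff k (f + g)) =
      dFun (PowerSeries.coeff k f) + dFun (PowerSeries.coeff k g)
    rw [map_add, map_add]

theorem formalD_mul (f g : FormalFun n M) : formalD (f * g) = f • formalD g + g • formalD f := by
  ext1
  funext k
  change dFun (PowerSeries.coeff k (f * g)) = _
  rw [FormalSeries.coeff_add, FormalSeries.coeff_smul, FormalSeries.coeff_smul,
    PowerSeries.coeff_mul, map_sum,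
    ← Finset.Nat.sum_antidiagonal_swap
      (f := fun p => PowerSeries.coeff p.1 g • (formalD f).coeff p.2), ← Finset.sum_add_distrib]
  exact Finset.sum_congr rfl fun p _ => dFun_mul _ _

variable (n M)

/-- The homomorphism `D : 𝒵^× → Ω¹(M)[[ħ]]`, `f ↦ f⁻¹ df`, from the multiplicative group of
invertible elements of `𝒵 = C^∞(M)[[ħ]]` to the additive group of formal one-forms. -/
def logD : Additive (FormalFun n M)ˣ →+ FormalOneForm n M where
  toFun f := ((f.toMul⁻¹ : (FormalFun n M)ˣ) : FormalFun n M) •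
    formalD (f.toMul : FormalFun n M)
  map_zero' := by
    have h := formalD_mul (1 : FormalFun n M) 1
    rw [mul_one, one_smul, left_eq_add] at h
    rw [toMul_zero, Units.val_one, h, smul_zero]
  map_add' f g := by
    rw [toMul_add, Units.val_mul, mul_inv, Units.val_mul, formalD_mul, smul_add, smul_smul,
      smul_smul, mul_right_comm, Units.inv_mul, one_mul, mul_assoc, Units.inv_mul, mul_one,
      add_comm]

/-- The closed formal one-forms `Z¹(M)[[ħ]]`. -/
def formalClosed : Set (FormalOneForm n M) := {β | ∀ k, (β.coeff k).IsClosed}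

/-- The group `d𝒵` of exact formal one-forms. -/
def formalExact : AddSubgroup (FormalOneForm n M) := (formalD (n := n) (M := M)).range

end FormalForms

section SingularCohomology

/-- Singular `k`-simplices of a space. -/
abbrev SingularSimplex (k : ℕ) (X : Type*) [TopologicalSpace X] : Type _ :=
  C(stdSimplex ℝ (Fin (k + 1)), X)

variable {X : Type*} [TopologicalSpace X]

/-- The `i`-th face of a singular simplex, opposite to the `i`-th vertex. -/
def SingularSimplex.face {k : ℕ} (i : Fin (k + 2)) (σ : SingularSimplex (k + 1) X) :
    SingularSimplex k X :=
  σ.comp ⟨stdSimplex.map i.succAbove, stdSimplex.continuous_map i.succAbove⟩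

variable (X)

/-- The coboundary `C^k(X, ℤ) → C^{k+1}(X, ℤ)` of singular cochains. An integral singular cochain,
that is, a homomorphism from the free abelian group on the singular `k`-simplices to `ℤ`, is given
by its values on the singular simplices. -/
def singularCoboundary (k : ℕ) : (SingularSimplex k X → ℤ) →+ (SingularSimplex (k + 1) X → ℤ) where
  toFun φ := fun σ => ∑ i : Fin (k + 2), (-1) ^ (i : ℕ) * φ (σ.face i)
  map_zero' := by
    funext σ
    simp
  map_add' φ ψ := by
    funext σ
    simp [mul_add, Finset.sum_add_distrib]

/-- The first singular cohomology group `H¹(X, ℤ)`: one-cocycles modulo coboundaries of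
zero-cochains. -/
abbrev SingularH1 : Type _ :=
  (singularCoboundary X 1).ker ⧸
    ((singularCoboundary X 0).range.addSubgroupOf (singularCoboundary X 1).ker)

end SingularCohomology

end

/-! Modulo exact forms, `D f` depends only on the leading coefficient of `f`. If `u` has constant
coefficient `1`, then `u = exp g` for a formal series `g`, and `D u = dg`. Exponentials and
logarithms in `ħ` are handled through the Euler operator `ħ d/dħ`: the equation `ħ u' = u ħ g'` can
be solved coefficient by coefficient for either unknown, and uniqueness of solutions gives `du = u
dg` (`formalD_eq_smul_of_euler_eq`). Together with the ordinary exponential of the leading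
coefficient this also shows that exact forms are logarithmic differentials. What remains is a
question about `f⁻¹ df` for nowhere vanishing smooth functions `f` on `M`.

Choose any logarithm `l` of such an `f`, possibly discontinuous. Along a singular `1`-simplex `f`
has a continuous logarithm, whose increment differs from that of `l` by `2πi` times an integer.
These integers form a cocycle `φ` (`exists_isLogCocycle`); another choice of `l` changes it by a
coboundary. The form `f⁻¹ df` is exact if and only if `f` is a constant on each component times the
exponential of a smooth function, that is, if and only if `φ` is a coboundary
(`IsLogCocycle.exists_dFun_eq_iff`).

Every cocycle occurs (`exists_units_isLogCocycle`). On a small chart ball `U_i` it is the coboundary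
of an integer function `c_i`, and differences `c_i - c_j` are locally constant on overlaps. With a
partition of unity `ρ_i`, the function `h = -∑ ρ_i c_i` becomes smooth on `U_j` after adding `c_j`,
so `f = exp(2πi h)` is smooth, and its cocycle agrees with the given one on simplices inside the
balls, hence everywhere.

The pairs `(f, φ)` form a group that maps onto both sides of the asserted isomorphism, and the two
maps have the same kernel. -/

open scoped Topology

noncomputable section

/-! ### Singular 1-cocycles: additivity, subdivision and locality -/

section Singular

variable {X : Type*} [TopologicalSpace X]

/-- The vertex `i` of the standard `k`-simplex. -/
abbrev simplexVertex {k : ℕ} (i : Fin (k + 1)) : stdSimplex ℝ (Fin (k + 1)) :=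
  stdSimplex.vertex i

namespace SingularSimplex

theorem face_apply_vertex {k : ℕ} (i : Fin (k + 2)) (σ : SingularSimplex (k + 1) X)
    (j : Fin (k + 1)) : σ.face i (simplexVertex j) = σ (simplexVertex (i.succAbove j)) := by
  change σ (stdSimplex.map i.succAbove (stdSimplex.vertex j)) = _
  rw [stdSimplex.map_vertex]

/-- A point as a singular `0`-simplex. -/
def point (x : X) : SingularSimplex 0 X := ContinuousMap.const _ x

theorem eq_point (σ : SingularSimplex 0 X) : σ = point (σ (simplexVertex 0)) := by
  ext t
  rw [Subsingleton.elim t (simplexVertex 0)]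
  rfl

end SingularSimplex

open SingularSimplex

theorem singularCoboundary_zero_apply (c : SingularSimplex 0 X → ℤ) (σ : SingularSimplex 1 X) :
    singularCoboundary X 0 c σ =
      c (point (σ (simplexVertex 1))) - c (point (σ (simplexVertex 0))) := by
  change ∑ i : Fin 2, (-1) ^ (i : ℕ) * c (σ.face i) = _
  rw [Fin.sum_univ_two, eq_point (σ.face 0), eq_point (σ.face 1), face_apply_vertex,
    face_apply_vertex]
  simp [sub_eq_add_neg]

theorem singularCoboundary_one_apply (φ : SingularSimplex 1 X → ℤ) (τ : SingularSimplex 2 X) :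
    singularCoboundary X 1 φ τ = φ (τ.face 0) - φ (τ.face 1) + φ (τ.face 2) := by
  change ∑ i : Fin 3, (-1) ^ (i : ℕ) * φ (τ.face i) = _
  rw [Fin.sum_univ_three]
  simp [sub_eq_add_neg]

section Segments

variable {E : Type*} [AddCommGroup E] [Module ℝ E] [TopologicalSpace E] [ContinuousAdd E]
  [ContinuousSMul ℝ E]

/-- The singular `1`-simplex that runs through the image of the segment from `a` to `b`. -/
def segmentSimplex (H : C(E, X)) (a b : E) : SingularSimplex 1 X where
  toFun t := H (t.1 0 • a + t.1 1 • b)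
  continuous_toFun := by
    have h (i : Fin 2) : Continuous fun t : stdSimplex ℝ (Fin 2) => t.1 i :=
      (continuous_apply i).comp continuous_subtype_val
    exact H.continuous.comp (((h 0).smul continuous_const).add ((h 1).smul continuous_const))

/-- The singular `2`-simplex given by the image of the triangle with vertices `a`, `b`, `c`. -/
def triangleSimplex (H : C(E, X)) (a b c : E) : SingularSimplex 2 X where
  toFun t := H (t.1 0 • a + t.1 1 • b + t.1 2 • c)
  continuous_toFun := by
    have h (i : Fin 3) : Continuous fun t : stdSimplex ℝ (Fin 3) => t.1 i :=
      (continuous_apply i).comp continuous_subtype_val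
    exact H.continuous.comp ((((h 0).smul continuous_const).add
      ((h 1).smul continuous_const)).add ((h 2).smul continuous_const))

theorem triangleSimplex_face_zero (H : C(E, X)) (a b c : E) :
    (triangleSimplex H a b c).face 0 = segmentSimplex H b c := by
  ext t
  change H (stdSimplex.map (Fin.succAbove 0) t 0 • a + stdSimplex.map (Fin.succAbove 0) t 1 • b +
    stdSimplex.map (Fin.succAbove 0) t 2 • c) = H (t 0 • b + t 1 • c)
  simp [FunOnFinite.linearMap_apply_apply, Finset.sum_filter, Fin.sum_univ_two]

theorem triangleSimplex_face_one (H : C(E, X)) (a b c : E) :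
    (triangleSimplex H a b c).face 1 = segmentSimplex H a c := by
  ext t
  change H (stdSimplex.map (Fin.succAbove 1) t 0 • a + stdSimplex.map (Fin.succAbove 1) t 1 • b +
    stdSimplex.map (Fin.succAbove 1) t 2 • c) = H (t 0 • a + t 1 • c)
  simp [FunOnFinite.linearMap_apply_apply, Finset.sum_filter, Fin.sum_univ_two, Fin.succAbove]

theorem triangleSimplex_face_two (H : C(E, X)) (a b c : E) :
    (triangleSimplex H a b c).face 2 = segmentSimplex H a b := by
  ext t
  change H (stdSimplex.map (Fin.succAbove 2) t 0 • a + stdSimplex.map (Fin.succAbove 2) t 1 • b +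
    stdSimplex.map (Fin.succAbove 2) t 2 • c) = H (t 0 • a + t 1 • b)
  simp [FunOnFinite.linearMap_apply_apply, Finset.sum_filter, Fin.sum_univ_two, Fin.succAbove,
    Fin.lt_def]

/-- A `1`-cocycle is additive along the edges of a triangle. -/
theorem cocycle_segmentSimplex {φ : SingularSimplex 1 X → ℤ} (hφ : singularCoboundary X 1 φ = 0)
    (H : C(E, X)) (a b c : E) :
    φ (segmentSimplex H a c) = φ (segmentSimplex H a b) + φ (segmentSimplex H b c) := by
  have h := singularCoboundary_one_apply φ (triangleSimplex H a b c)
  rw [hφ, triangleSimplex_face_zero, triangleSimplex_face_one, triangleSimplex_face_two] at h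
  simp only [Pi.zero_apply] at h
  lia

theorem cocycle_segmentSimplex_self {φ : SingularSimplex 1 X → ℤ}
    (hφ : singularCoboundary X 1 φ = 0) (H : C(E, X)) (a : E) :
    φ (segmentSimplex H a a) = 0 := by
  have h := cocycle_segmentSimplex hφ H a a a
  lia

end Segments

/-- The point of the standard `1`-simplex with parameter `s`, clamped to the unit interval. -/
def clampedSimplexPoint : C(ℝ, stdSimplex ℝ (Fin 2)) where
  toFun s := stdSimplexHomeomorphUnitInterval.symm (Set.projIcc 0 1 zero_le_one s)
  continuous_toFun := by fun_prop

theorem clampedSimplexPoint_apply (t : stdSimplex ℝ (Fin 2)) : clampedSimplexPoint (t 1) = t := by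
  change stdSimplexHomeomorphUnitInterval.symm (Set.projIcc 0 1 zero_le_one (t 1)) = t
  rw [Homeomorph.symm_apply_eq]
  exact Set.projIcc_of_mem zero_le_one ⟨t.2.1 1, stdSimplex.le_one t 1⟩

theorem clampedSimplexPoint_zero : clampedSimplexPoint 0 = simplexVertex 0 := by
  rw [← clampedSimplexPoint_apply (simplexVertex 0)]
  simp

theorem clampedSimplexPoint_one : clampedSimplexPoint 1 = simplexVertex 1 := by
  rw [← clampedSimplexPoint_apply (simplexVertex 1)]
  simp

theorem segmentSimplex_clamped (σ : SingularSimplex 1 X) :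
    segmentSimplex (σ.comp clampedSimplexPoint) 0 1 = σ := by
  ext t
  change σ (clampedSimplexPoint (t 0 • 0 + t 1 • 1)) = σ t
  rw [smul_zero, zero_add, smul_eq_mul, mul_one, clampedSimplexPoint_apply]

/-- Additivity along the subdivision of `[0, 1]` into `N + 1` equal parts, each shorter than `δ`. No
barycentric subdivision or chain homotopy is needed in degree one. -/
theorem cocycle_eq_zero_of_small_segments {φ : SingularSimplex 1 X → ℤ}
    (hφ : singularCoboundary X 1 φ = 0) (H : C(ℝ, X)) {δ : ℝ} (hδ : 0 < δ)
    (h : ∀ s ∈ Set.Icc (0 : ℝ) 1, ∀ t ∈ Set.Icc (0 : ℝ) 1, |t - s| < δ →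
      φ (segmentSimplex H s t) = 0) :
    φ (segmentSimplex H 0 1) = 0 := by
  obtain ⟨N, hN⟩ := exists_nat_one_div_lt hδ
  have hN0 : (0 : ℝ) < N + 1 := by positivity
  have key : ∀ k : ℕ, k ≤ N + 1 → φ (segmentSimplex H 0 ((k : ℝ) / (N + 1))) = 0 := by
    intro k
    induction k with
    | zero =>
      intro _
      simpa using cocycle_segmentSimplex_self hφ H 0
    | succ k ih =>
      intro hk
      have hk' : (k : ℝ) + 1 ≤ N + 1 := by exact_mod_cast hk
      rw [cocycle_segmentSimplex hφ H 0 ((k : ℝ) / (N + 1)), ih (by lia), zero_add]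
      push_cast
      refine h _ ⟨by positivity, (div_le_one hN0).2 (by linarith)⟩ _
        ⟨by positivity, (div_le_one hN0).2 hk'⟩ ?_
      rwa [← sub_div, add_sub_cancel_left, abs_of_pos (by positivity)]
  have h1 := key (N + 1) le_rfl
  rwa [Nat.cast_add, Nat.cast_one, div_self hN0.ne'] at h1

/-- A `1`-cocycle that vanishes on all `1`-simplices inside the members of an open cover is zero. -/
theorem cocycle_eq_zero_of_cover {φ : SingularSimplex 1 X → ℤ}
    (hφ : singularCoboundary X 1 φ = 0) {ι : Type*} {U : ι → Set X} (hU : ∀ i, IsOpen (U i))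
    (hcover : ∀ x, ∃ i, x ∈ U i)
    (h : ∀ i, ∀ σ : SingularSimplex 1 X, (∀ t, σ t ∈ U i) → φ σ = 0) : φ = 0 := by
  funext σ
  rw [← segmentSimplex_clamped σ]
  set H := σ.comp clampedSimplexPoint
  -- A Lebesgue number of the pulled-back cover of `[0, 1]`: segments shorter than `δ` are mapped
  -- into a single member of the cover.
  obtain ⟨δ, hδ, hball⟩ := lebesgue_number_lemma_of_metric (isCompact_Icc (a := (0 : ℝ)) (b := 1))
    (fun i => (hU i).preimage H.continuous)
    (fun s _ => Set.mem_iUnion.2 (hcover (H s)))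
  refine cocycle_eq_zero_of_small_segments hφ H hδ fun s hs t _ hst => ?_
  obtain ⟨i, hi⟩ := hball s hs
  refine h i _ fun r => hi ?_
  rw [Metric.mem_ball, Real.dist_eq]
  have hr : r.1 0 = 1 - r.1 1 := eq_sub_of_add_eq (stdSimplex.add_eq_one r)
  have h0 : 0 ≤ r.1 1 := r.2.1 1
  have h1 : r.1 1 ≤ 1 := stdSimplex.le_one r 1
  have : r.1 0 • s + r.1 1 • t - s = r.1 1 * (t - s) := by
    rw [hr, smul_eq_mul, smul_eq_mul]
    ring
  rw [this, abs_mul, abs_of_nonneg h0]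
  exact (mul_le_of_le_one_left (abs_nonneg _) h1).trans_lt hst

/-- A path as a singular `1`-simplex. -/
def Path.toSimplex {x y : X} (γ : Path x y) : SingularSimplex 1 X :=
  γ.toContinuousMap.comp ⟨stdSimplexHomeomorphUnitInterval, Homeomorph.continuous _⟩

theorem Path.toSimplex_zero {x y : X} (γ : Path x y) : γ.toSimplex (simplexVertex 0) = x := by
  change γ (stdSimplexHomeomorphUnitInterval _) = x
  rw [stdSimplexHomeomorphUnitInterval_zero, γ.source]

theorem Path.toSimplex_one {x y : X} (γ : Path x y) : γ.toSimplex (simplexVertex 1) = y := by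
  change γ (stdSimplexHomeomorphUnitInterval _) = y
  rw [stdSimplexHomeomorphUnitInterval_one, γ.target]

end Singular

/-! ### Local primitives of cocycles on chart balls -/

section StarShaped

variable {X : Type*} [TopologicalSpace X]

open SingularSimplex

/-- The part of the domain of a chart that corresponds to a ball of the model space. -/
def chartBall {E : Type*} [PseudoMetricSpace E] (e : OpenPartialHomeomorph X E)
    (p : E) (r : ℝ) : Set X :=
  e.source ∩ e ⁻¹' Metric.ball p r

theorem isOpen_chartBall {E : Type*} [PseudoMetricSpace E] (e : OpenPartialHomeomorph X E)
    (p : E) (r : ℝ) :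
    IsOpen (chartBall e p r) :=
  e.isOpen_inter_preimage Metric.isOpen_ball

/-- On a chart ball, a `1`-cocycle is the coboundary of a function. -/
theorem exists_primitive_chartBall {E : Type*} [NormedAddCommGroup E] [NormedSpace ℝ E]
    {φ : SingularSimplex 1 X → ℤ}
    (hφ : singularCoboundary X 1 φ = 0) (e : OpenPartialHomeomorph X E) (p : E) {r : ℝ}
    (hr : Metric.ball p r ⊆ e.target) :
    ∃ c : X → ℤ, ∀ σ : SingularSimplex 1 X, (∀ t, σ t ∈ chartBall e p r) →
      φ σ = c (σ (simplexVertex 1)) - c (σ (simplexVertex 0)) := by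
  classical
  -- Clamping the parameter makes rays and homotopies defined on all of `ℝ` or `ℝ × ℝ` without
  -- leaving the ball, so that they are admissible arguments of `segmentSimplex`.
  let clamp : ℝ → ℝ := fun s => Set.projIcc (0 : ℝ) 1 zero_le_one s
  have hclamp : Continuous clamp := continuous_subtype_val.comp continuous_projIcc
  have hmem : ∀ s : ℝ, ∀ y ∈ Metric.ball p r, p + clamp s • (y - p) ∈ Metric.ball p r := by
    intro s y hy
    have h0 : 0 ≤ clamp s := (Set.projIcc (0 : ℝ) 1 zero_le_one s).2.1
    have h1 : clamp s ≤ 1 := (Set.projIcc (0 : ℝ) 1 zero_le_one s).2.2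
    rw [mem_ball_iff_norm] at hy ⊢
    rw [add_sub_cancel_left, norm_smul, Real.norm_of_nonneg h0]
    exact (mul_le_of_le_one_left (norm_nonneg _) h1).trans_lt hy
  have hcont : ∀ {Y : Type} [TopologicalSpace Y] {f : Y → E}, Continuous f →
      (∀ y, f y ∈ Metric.ball p r) → Continuous fun y => e.symm (f y) := by
    intro Y _ f hf hfr
    exact e.continuousOn_symm.comp_continuous hf fun y => hr (hfr y)
  let ray : ∀ y : E, y ∈ Metric.ball p r → C(ℝ, X) := fun y hy =>
    ⟨fun s => e.symm (p + clamp s • (y - p)), hcont (by fun_prop) fun s => hmem s y hy⟩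
  -- The primitive at `x` is the value of `φ` on the ray from the centre to `x`; its values off the
  -- chart ball play no role.
  refine ⟨fun x => if hx : e x ∈ Metric.ball p r then φ (segmentSimplex (ray (e x) hx) 0 1) else 0,
    fun σ hσ => ?_⟩
  have hcσ : Continuous fun u : ℝ => e (σ (clampedSimplexPoint u)) :=
    e.continuousOn.comp_continuous (by fun_prop) fun u => (hσ _).1
  -- The cone over `σ` as a map of the square: the edge `s = 0` collapses to the centre, `s = 1` is
  -- `σ`, and the other two edges are the rays to the endpoints of `σ`.
  let H : C(ℝ × ℝ, X) :=
    ⟨fun q => e.symm (p + clamp q.1 • (e (σ (clampedSimplexPoint q.2)) - p)),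
      hcont (continuous_const.add ((hclamp.comp continuous_fst).smul
        ((hcσ.comp continuous_snd).sub continuous_const))) fun q => hmem _ _ (hσ _).2⟩
  have c0 : clamp 0 = 0 := by simp [clamp]
  have c1 : clamp 1 = 1 := by simp [clamp]
  have e1 : segmentSimplex H (0, 0) (1, 0) = segmentSimplex (ray _ (hσ (simplexVertex 0)).2) 0 1 := by
    ext t
    change e.symm (p + clamp (t 0 * 0 + t 1 * 1) •
      (e (σ (clampedSimplexPoint (t 0 * 0 + t 1 * 0))) - p)) = e.symm (p + clamp
        (t 0 * 0 + t 1 * 1) • (e (σ (simplexVertex 0)) - p))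
    rw [mul_zero, mul_zero, add_zero, clampedSimplexPoint_zero]
  have e2 : segmentSimplex H (0, 1) (1, 1) = segmentSimplex (ray _ (hσ (simplexVertex 1)).2) 0 1 := by
    ext t
    change e.symm (p + clamp (t 0 * 0 + t 1 * 1) •
      (e (σ (clampedSimplexPoint (t 0 * 1 + t 1 * 1))) - p)) = e.symm (p + clamp
        (t 0 * 0 + t 1 * 1) • (e (σ (simplexVertex 1)) - p))
    rw [mul_one, mul_one, stdSimplex.add_eq_one, clampedSimplexPoint_one]
  have e3 : segmentSimplex H (1, 0) (1, 1) = σ := by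
    ext t
    change e.symm (p + clamp (t 0 * 1 + t 1 * 1) •
      (e (σ (clampedSimplexPoint (t 0 * 0 + t 1 * 1))) - p)) = σ t
    rw [mul_one, mul_one, mul_zero, zero_add, stdSimplex.add_eq_one, c1, clampedSimplexPoint_apply,
      one_smul, add_sub_cancel, e.left_inv (hσ t).1]
  have e4 : segmentSimplex H (0, 0) (0, 1) = segmentSimplex (ContinuousMap.const ℝ (e.symm p)) 0 0 := by
    ext t
    change e.symm (p + clamp (t 0 * 0 + t 1 * 0) • _) = e.symm p
    rw [mul_zero, mul_zero, add_zero, c0, zero_smul, add_zero]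
  -- The two triangles of the square share the diagonal; comparing its two values expresses `φ σ`
  -- through the rays.
  have h1 := cocycle_segmentSimplex hφ H (0, 0) (1, 0) (1, 1)
  have h2 := cocycle_segmentSimplex hφ H (0, 0) (0, 1) (1, 1)
  rw [e1, e3] at h1
  rw [e2, e4, cocycle_segmentSimplex_self hφ] at h2
  beta_reduce
  rw [dif_pos (show e _ ∈ Metric.ball p r from (hσ (simplexVertex 0)).2),
    dif_pos (show e _ ∈ Metric.ball p r from (hσ (simplexVertex 1)).2)]
  lia

end StarShaped

/-! ### The integral cocycle of a logarithm -/

section LogCocycle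

variable {X : Type*} [TopologicalSpace X]

open SingularSimplex Complex

/-- The exponential is a covering over the nonzero complex numbers, and the simplex is contractible
and locally path connected, so maps from it lift. -/
theorem exists_continuous_log_on_stdSimplex {k : ℕ} (g : C(stdSimplex ℝ (Fin (k + 1)), ℂ))
    (hg : ∀ t, g t ≠ 0) :
    ∃ L : C(stdSimplex ℝ (Fin (k + 1)), ℂ), ∀ t, exp (L t) = g t := by
  have hconv : Convex ℝ (stdSimplex ℝ (Fin (k + 1))) := convex_stdSimplex ℝ _
  have : ContractibleSpace (stdSimplex ℝ (Fin (k + 1))) :=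
    hconv.contractibleSpace ⟨_, (simplexVertex 0).2⟩
  have : LocallyPathConnectedSpace (stdSimplex ℝ (Fin (k + 1))) := hconv.locallyPathConnectedSpace
  obtain ⟨L, ⟨-, hL⟩, -⟩ := isCoveringMapOn_exp.existsUnique_continuousMap_lifts g
    (a₀ := simplexVertex 0) (exp_log (hg _)) hg
  exact ⟨L, fun t => congrFun hL t⟩

/-- The difference divided by `2πi` is continuous and integer valued, hence constant on a
preconnected space. This makes increments of lifts independent of the lift. -/
theorem exists_int_eq_of_exp_eq {Y : Type*} [TopologicalSpace Y] [PreconnectedSpace Y]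
    [Nonempty Y] {L L' : Y → ℂ} (hL : Continuous L) (hL' : Continuous L')
    (h : ∀ t, exp (L t) = exp (L' t)) : ∃ m : ℤ, ∀ t, L t = L' t + m * (2 * Real.pi * I) := by
  choose m hm using fun t => exp_eq_exp_iff_exists_int.1 (h t)
  have hcont : Continuous fun t => (m t : ℂ) := by
    have : (fun t => (m t : ℂ)) = fun t => (L t - L' t) / (2 * Real.pi * I) := by
      funext t
      rw [hm t, add_sub_cancel_left, mul_div_cancel_right₀ _ two_pi_I_ne_zero]
    rw [this]
    fun_prop
  have hcont' : Continuous m :=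
    Complex.isClosedEmbedding_intCast.isInducing.continuous_iff.2 hcont
  obtain ⟨t₀⟩ := ‹Nonempty Y›
  exact ⟨m t₀, fun t => by rw [hm t, PreconnectedSpace.constant ‹_› hcont']⟩

/-- The integral cochain `φ` measures the failure of the (discontinuous) logarithm `l` of `f` to
be continuous along paths. -/
structure IsLogCocycle (f l : X → ℂ) (φ : SingularSimplex 1 X → ℤ) : Prop where
  exp_eq : ∀ x, exp (l x) = f x
  lift_sub_lift : ∀ (σ : SingularSimplex 1 X) (L : C(stdSimplex ℝ (Fin 2), ℂ)),
    (∀ t, exp (L t) = f (σ t)) → L (simplexVertex 1) - L (simplexVertex 0) =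
      l (σ (simplexVertex 1)) - l (σ (simplexVertex 0)) + φ σ * (2 * Real.pi * I)

namespace IsLogCocycle

theorem of_continuous {f l : X → ℂ} (hl : Continuous l) (h : ∀ x, exp (l x) = f x) :
    IsLogCocycle f l 0 := by
  refine ⟨h, fun σ L hL => ?_⟩
  obtain ⟨m, hm⟩ := exists_int_eq_of_exp_eq L.continuous (hl.comp σ.continuous)
    fun t => (hL t).trans (h _).symm
  simp [hm]

theorem ne_zero {f l : X → ℂ} {φ : SingularSimplex 1 X → ℤ} (h : IsLogCocycle f l φ) (x : X) :
    f x ≠ 0 :=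
  h.exp_eq x ▸ exp_ne_zero _

theorem exists_lift {f l : X → ℂ} {φ : SingularSimplex 1 X → ℤ} (h : IsLogCocycle f l φ)
    (hf : Continuous f) {k : ℕ} (σ : SingularSimplex k X) :
    ∃ L : C(stdSimplex ℝ (Fin (k + 1)), ℂ), ∀ t, exp (L t) = f (σ t) :=
  exists_continuous_log_on_stdSimplex ⟨fun t => f (σ t), hf.comp σ.continuous⟩ fun _ => h.ne_zero _

theorem mul {f g l l' : X → ℂ} {φ ψ : SingularSimplex 1 X → ℤ} (h : IsLogCocycle f l φ)
    (h' : IsLogCocycle g l' ψ) (hf : Continuous f) :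
    IsLogCocycle (f * g) (l + l') (φ + ψ) := by
  refine ⟨fun x => by simp [exp_add, h.exp_eq, h'.exp_eq], fun σ L hL => ?_⟩
  obtain ⟨K, hK⟩ := h.exists_lift hf σ
  have h1 := h.lift_sub_lift σ K hK
  have h2 := h'.lift_sub_lift σ (L - K) fun t => by
    rw [ContinuousMap.sub_apply, exp_sub, hL, hK, Pi.mul_apply, mul_div_cancel_left₀ _ (h.ne_zero _)]
  simp only [ContinuousMap.sub_apply, Pi.add_apply, Int.cast_add] at h2 ⊢
  linear_combination h1 + h2

theorem inv {f l : X → ℂ} {φ : SingularSimplex 1 X → ℤ} (h : IsLogCocycle f l φ) :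
    IsLogCocycle f⁻¹ (-l) (-φ) := by
  refine ⟨fun x => by simp [exp_neg, h.exp_eq], fun σ L hL => ?_⟩
  have h1 := h.lift_sub_lift σ (-L) fun t => by
    rw [ContinuousMap.neg_apply, exp_neg, hL, Pi.inv_apply, inv_inv]
  simp only [ContinuousMap.neg_apply, Pi.neg_apply, Int.cast_neg] at h1 ⊢
  linear_combination -h1

/-- Cochains that belong to two logarithms of the same function differ by a coboundary. -/
theorem sub_eq_coboundary {f l l' : X → ℂ} {φ ψ : SingularSimplex 1 X → ℤ}
    (h : IsLogCocycle f l φ) (h' : IsLogCocycle f l' ψ) (hf : Continuous f) {c : X → ℤ}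
    (hc : ∀ x, l' x = l x + c x * (2 * Real.pi * I)) :
    φ = ψ + singularCoboundary X 0 fun ρ => c (ρ (simplexVertex 0)) := by
  funext σ
  obtain ⟨L, hL⟩ := h.exists_lift hf σ
  have h1 := h.lift_sub_lift σ L hL
  have h2 := h'.lift_sub_lift σ L hL
  rw [Pi.add_apply, singularCoboundary_zero_apply]
  change φ σ = ψ σ + (c (σ (simplexVertex 1)) - c (σ (simplexVertex 0)))
  rw [hc, hc] at h2
  have h3 : ((φ σ : ℂ)) * (2 * Real.pi * I) =
      ((ψ σ + (c (σ (simplexVertex 1)) - c (σ (simplexVertex 0))) : ℤ) : ℂ) *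
        (2 * Real.pi * I) := by
    push_cast
    linear_combination h2 - h1
  exact_mod_cast mul_right_cancel₀ two_pi_I_ne_zero h3

theorem exists_sub_eq_coboundary {f l l' : X → ℂ} {φ ψ : SingularSimplex 1 X → ℤ}
    (h : IsLogCocycle f l φ) (h' : IsLogCocycle f l' ψ) (hf : Continuous f) :
    ∃ c, φ = ψ + singularCoboundary X 0 c := by
  choose c hc using fun x => exp_eq_exp_iff_exists_int.1 ((h'.exp_eq x).trans (h.exp_eq x).symm)
  exact ⟨_, h.sub_eq_coboundary h' hf hc⟩

/-- Changing the logarithm changes the cochain by a coboundary. -/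
theorem add_int {f l : X → ℂ} {φ : SingularSimplex 1 X → ℤ} {c : SingularSimplex 0 X → ℤ}
    (h : IsLogCocycle f l (φ + singularCoboundary X 0 c)) :
    IsLogCocycle f (fun x => l x + c (point x) * (2 * Real.pi * I)) φ := by
  refine ⟨fun x => by rw [exp_add, exp_int_mul_two_pi_mul_I, mul_one, h.exp_eq], fun σ L hL => ?_⟩
  have h1 := h.lift_sub_lift σ L hL
  rw [Pi.add_apply, singularCoboundary_zero_apply] at h1
  push_cast at h1
  linear_combination h1

end IsLogCocycle

/-- Every logarithm of a continuous function belongs to a singular cocycle. -/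
theorem exists_isLogCocycle {f l : X → ℂ} (hf : Continuous f) (hl : ∀ x, exp (l x) = f x) :
    ∃ φ : SingularSimplex 1 X → ℤ, singularCoboundary X 1 φ = 0 ∧ IsLogCocycle f l φ := by
  have hne : ∀ x, f x ≠ 0 := fun x => hl x ▸ exp_ne_zero _
  have hlift : ∀ {k : ℕ} (σ : SingularSimplex k X),
      ∃ L : C(stdSimplex ℝ (Fin (k + 1)), ℂ), ∀ t, exp (L t) = f (σ t) := fun σ =>
    exists_continuous_log_on_stdSimplex ⟨fun t => f (σ t), hf.comp σ.continuous⟩ fun _ => hne _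
  choose L hL using fun σ : SingularSimplex 1 X => hlift σ
  choose m hm using fun (σ : SingularSimplex 1 X) (t : stdSimplex ℝ (Fin 2)) =>
    exp_eq_exp_iff_exists_int.1 ((hL σ t).trans (hl (σ t)).symm)
  -- `m σ t` is the integer by which the chosen lift along `σ` exceeds `l` at `t`, in units of
  -- `2πi`.
  have hlog : IsLogCocycle f l fun σ => m σ (simplexVertex 1) - m σ (simplexVertex 0) := by
    refine ⟨hl, fun σ K hK => ?_⟩
    obtain ⟨j, hj⟩ := exists_int_eq_of_exp_eq K.continuous (L σ).continuous
      fun t => (hK t).trans (hL σ t).symm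
    rw [hj, hj, hm, hm]
    push_cast
    ring
  refine ⟨_, ?_, hlog⟩
  funext τ
  obtain ⟨K, hK⟩ := hlift τ
  -- A single lift over the whole triangle restricts to the three edges, so the increments of the
  -- lift and of `l` both cancel around the boundary.
  have key (i : Fin 3) := hlog.lift_sub_lift (τ.face i) (SingularSimplex.face i K) fun t => hK _
  have h0 := key 0
  have h1 := key 1
  have h2 := key 2
  simp only [face_apply_vertex] at h0 h1 h2
  rw [singularCoboundary_one_apply]
  have e0 : (0 : Fin 3).succAbove (0 : Fin 2) = 1 := rfl
  have e1 : (0 : Fin 3).succAbove (1 : Fin 2) = 2 := rfl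
  have e2 : (1 : Fin 3).succAbove (0 : Fin 2) = 0 := rfl
  have e3 : (1 : Fin 3).succAbove (1 : Fin 2) = 2 := rfl
  have e4 : (2 : Fin 3).succAbove (0 : Fin 2) = 0 := rfl
  have e5 : (2 : Fin 3).succAbove (1 : Fin 2) = 1 := rfl
  rw [e0, e1] at h0
  rw [e2, e3] at h1
  rw [e4, e5] at h2
  generalize m (τ.face 0) (simplexVertex 1) - m (τ.face 0) (simplexVertex 0) = a at *
  generalize m (τ.face 1) (simplexVertex 1) - m (τ.face 1) (simplexVertex 0) = b at *
  generalize m (τ.face 2) (simplexVertex 1) - m (τ.face 2) (simplexVertex 0) = c at *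
  have h3 : ((a - b + c : ℤ) : ℂ) * (2 * Real.pi * I) = 0 := by
    push_cast
    linear_combination h1 - h0 - h2
  exact_mod_cast (mul_eq_zero.1 h3).resolve_right two_pi_I_ne_zero

/-- A logarithm without monodromy is locally given by the principal branch. -/
theorem IsLogCocycle.eventually_eq [LocallyPathConnectedSpace X] {f l : X → ℂ} (hf : Continuous f)
    (h : IsLogCocycle f l 0) (x₀ : X) : ∀ᶠ x in 𝓝 x₀, l x = l x₀ + log (f x / f x₀) := by
  have hne := h.ne_zero x₀
  have hU : {x | f x / f x₀ ∈ slitPlane} ∈ 𝓝 x₀ :=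
    (isOpen_slitPlane.preimage (hf.div_const (f x₀))).mem_nhds (by simp [hne])
  obtain ⟨V, ⟨hV, hVc⟩, hVU⟩ := (path_connected_basis x₀).mem_iff.1 hU
  filter_upwards [hV] with x hx
  obtain ⟨γ, hγ⟩ := hVc.joinedIn x₀ (mem_of_mem_nhds hV) x hx
  -- The principal branch of `f / f x₀`, shifted by `l x₀`, is a continuous logarithm along a path
  -- that stays in the slit neighbourhood; with zero cocycle, `l` has the same increment.
  have h1 := h.lift_sub_lift γ.toSimplex
    ⟨fun t => l x₀ + log (f (γ.toSimplex t) / f x₀), continuous_const.add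
      ((hf.comp γ.toSimplex.continuous).div_const (f x₀) |>.clog fun t => hVU (hγ _))⟩ fun t => by
        change exp (l x₀ + log (f (γ.toSimplex t) / f x₀)) = _
        rw [exp_add, h.exp_eq, exp_log (div_ne_zero (h.ne_zero _) hne), mul_div_cancel₀ _ hne]
  simp only [ContinuousMap.coe_mk, Path.toSimplex_zero, Path.toSimplex_one, div_self hne,
    log_one, Pi.zero_apply, Int.cast_zero, zero_mul] at h1
  linear_combination -h1

end LogCocycle

/-! ### Formal exponentials and logarithms through the Euler operator -/

section FormalExponential

open PowerSeries

namespace FormalSeries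

variable {A W : Type*} [CommRing A] [AddCommGroup W] [Module A W]

/-- The Euler operator `ħ d/dħ` on formal power series with coefficients in a group. -/
def euler : FormalSeries W →+ FormalSeries W where
  toFun β := ⟨fun k => k • β.coeff k⟩
  map_zero' := by
    ext k
    simp
  map_add' α β := by
    ext k
    simp

theorem coeff_euler (β : FormalSeries W) (k : ℕ) : (euler β).coeff k = k • β.coeff k := rfl

end FormalSeries

namespace PowerSeries

/-- The Euler operator `ħ d/dħ` on formal power series. -/
def euler {A : Type*} [CommRing A] (f : PowerSeries A) : PowerSeries A :=
  PowerSeries.mk fun k => k • PowerSeries.coeff k f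

theorem coeff_euler {A : Type*} [CommRing A] (f : PowerSeries A) (k : ℕ) :
    PowerSeries.coeff k f.euler = k • PowerSeries.coeff k f :=
  PowerSeries.coeff_mk _ _

end PowerSeries

variable {A W : Type*} [CommRing A] [AddCommGroup W] [Module A W]

theorem FormalSeries.euler_smul (f : PowerSeries A) (β : FormalSeries W) :
    FormalSeries.euler (f • β) = f.euler • β + f • FormalSeries.euler β := by
  ext k
  simp only [FormalSeries.coeff_euler, FormalSeries.coeff_add, FormalSeries.coeff_smul,
    PowerSeries.coeff_euler, Finset.smul_sum, ← Finset.sum_add_distrib]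
  refine Finset.sum_congr rfl fun p hp => ?_
  rw [← Finset.HasAntidiagonal.mem_antidiagonal.1 hp, add_smul, smul_comm p.2, smul_assoc]

variable [Algebra ℝ A]

/-- Inverses of positive integers in `A` act on `W`, which is therefore torsion-free. This allows
the factor `k` produced by the Euler operator to be cancelled. -/
theorem nsmul_eq_zero_of_algebra_real (A : Type*) {W : Type*} [CommRing A] [Algebra ℝ A]
    [AddCommGroup W] [Module A W] {k : ℕ} (hk : k ≠ 0) {w : W} (h : k • w = 0) : w = 0 := by
  have h1 : algebraMap ℝ A ((k : ℝ)⁻¹) • (k • w) = w := by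
    rw [← Nat.cast_smul_eq_nsmul A, smul_smul, ← map_natCast (algebraMap ℝ A), ← map_mul,
      inv_mul_cancel₀ (Nat.cast_ne_zero.2 hk), map_one, one_smul]
  rw [← h1, h, smul_zero]

/-- A solution of the formal differential equation `ħ β' = ħ g' β` with `β 0 = 0` vanishes. -/
theorem FormalSeries.eq_zero_of_euler_eq_smul {g : PowerSeries A} {β : FormalSeries W}
    (h0 : β.coeff 0 = 0) (h : FormalSeries.euler β = g.euler • β) : β = 0 := by
  ext k
  induction k using Nat.strong_induction_on with
  | _ k ih =>
    rcases eq_or_ne k 0 with rfl | hk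
    · exact h0
    · refine nsmul_eq_zero_of_algebra_real A hk ?_
      -- The Euler derivative of `g` has no constant term, so `k β_k` involves only `β_j` with `j <
      -- k`.
      rw [← FormalSeries.coeff_euler, h, FormalSeries.coeff_smul]
      refine Finset.sum_eq_zero fun p hp => ?_
      have hp' := Finset.HasAntidiagonal.mem_antidiagonal.1 hp
      rcases eq_or_ne p.1 0 with h1 | h1
      · rw [PowerSeries.coeff_euler, h1, zero_smul, zero_smul]
      · rw [ih p.2 (by lia), FormalSeries.coeff_zero, smul_zero]

/-- The coefficients of the solution `u` of `ħ u' = u ħ g'` with constant coefficient `a`. -/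
def formalExpCoeff (a : A) (g : PowerSeries A) : ℕ → A
  | 0 => a
  | k + 1 => ((k + 1 : ℕ) : ℝ)⁻¹ • ∑ i : Fin (k + 1), formalExpCoeff a g i *
      ((k + 1 - i) • PowerSeries.coeff (k + 1 - i) g)

/-- This supplies `exp g` without substitution of power series. The constant coefficient is free
because the Euler operator kills constants; later it is taken to be the exponential of `g_0`. -/
theorem exists_euler_eq_mul_euler (a : A) (g : PowerSeries A) :
    ∃ u : PowerSeries A, PowerSeries.coeff 0 u = a ∧ u.euler = u * g.euler := by
  refine ⟨PowerSeries.mk (formalExpCoeff a g), by simp [formalExpCoeff], ?_⟩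
  ext k
  rw [PowerSeries.coeff_euler, PowerSeries.coeff_mul,
    Finset.Nat.sum_antidiagonal_eq_sum_range_succ_mk, Finset.sum_range_succ]
  simp only [PowerSeries.coeff_euler, PowerSeries.coeff_mk, tsub_self, zero_smul, mul_zero,
    add_zero]
  cases k with
  | zero => simp
  | succ k =>
    rw [formalExpCoeff, ← Nat.cast_smul_eq_nsmul ℝ (k + 1), smul_smul,
      mul_inv_cancel₀ (Nat.cast_ne_zero.2 k.succ_ne_zero), one_smul, Finset.sum_range]

/-- The formal logarithm: `u⁻¹` times the Euler derivative of `u` has no constant term, so it can be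
integrated by dividing the `k`-th coefficient by `k`. -/
theorem exists_euler_eq_units_mul_euler (u : (PowerSeries A)ˣ) (b : A) :
    ∃ g : PowerSeries A, PowerSeries.coeff 0 g = b ∧
      PowerSeries.euler (u : PowerSeries A) = u * g.euler := by
  set v : PowerSeries A := (u⁻¹ : (PowerSeries A)ˣ) * PowerSeries.euler (u : PowerSeries A) with hv
  refine ⟨PowerSeries.mk fun k => if k = 0 then b else (k : ℝ)⁻¹ • PowerSeries.coeff k v,
    by simp, ?_⟩
  rw [← Units.inv_mul_eq_iff_eq_mul, ← hv]
  ext k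
  rw [PowerSeries.coeff_euler, PowerSeries.coeff_mk]
  rcases eq_or_ne k 0 with rfl | hk
  · rw [zero_smul, hv, PowerSeries.coeff_mul, Finset.Nat.antidiagonal_zero, Finset.sum_singleton,
      PowerSeries.coeff_euler, zero_smul, mul_zero]
  · rw [if_neg hk, ← Nat.cast_smul_eq_nsmul ℝ k, smul_smul,
      mul_inv_cancel₀ (Nat.cast_ne_zero.2 hk), one_smul]

end FormalExponential

/-! ### Reduction of `D` to the leading coefficient -/

section FormalLogarithm

variable {n : ℕ} {M : Type*} [TopologicalSpace M] [ChartedSpace (EuclideanSpace ℝ (Fin n)) M]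
  [IsManifold (𝓡 n) ∞ M]

theorem coeff_formalD (f : FormalFun n M) (k : ℕ) :
    (formalD f).coeff k = dFun (PowerSeries.coeff k f) := rfl

theorem formalD_euler (f : FormalFun n M) :
    formalD (PowerSeries.euler f) = FormalSeries.euler (formalD f) := by
  ext1
  funext k
  rw [coeff_formalD, PowerSeries.coeff_euler, map_nsmul, FormalSeries.coeff_euler, coeff_formalD]

/-- If `u` and `exp g` solve the same formal differential equation, then `du = u dg`. -/
theorem formalD_eq_smul_of_euler_eq {u g : FormalFun n M}
    (h0 : dFun (PowerSeries.coeff 0 u) = PowerSeries.coeff 0 u • dFun (PowerSeries.coeff 0 g))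
    (h : PowerSeries.euler u = u * PowerSeries.euler g) : formalD u = u • formalD g := by
  rw [← sub_eq_zero]
  -- The defect `du - u dg` solves the same linear Euler equation as `u`, with zero initial value by
  -- `h0`.
  refine FormalSeries.eq_zero_of_euler_eq_smul (g := g) ?_ ?_
  · rw [sub_eq_add_neg, FormalSeries.coeff_add, FormalSeries.coeff_neg, FormalSeries.coeff_smul,
      coeff_formalD, Finset.Nat.antidiagonal_zero, Finset.sum_singleton, coeff_formalD, h0,
      add_neg_cancel]
  · rw [map_sub, FormalSeries.euler_smul, ← formalD_euler, ← formalD_euler, h, formalD_mul,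
      smul_sub, smul_smul, mul_comm u]
    abel

theorem logD_apply (f : (FormalFun n M)ˣ) :
    logD n M (Additive.ofMul f) =
      ((f⁻¹ : (FormalFun n M)ˣ) : FormalFun n M) • formalD (f : FormalFun n M) := rfl

theorem logD_eq_iff (f : (FormalFun n M)ˣ) (β : FormalOneForm n M) :
    logD n M (Additive.ofMul f) = β ↔ formalD (f : FormalFun n M) = (f : FormalFun n M) • β := by
  rw [logD_apply]
  constructor
  · rintro rfl
    rw [smul_smul, Units.mul_inv, one_smul]
  · intro h
    rw [h, smul_smul, Units.inv_mul, one_smul]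

/-- A nowhere vanishing function as an invertible constant formal power series. -/
def constUnit : (SmoothFun n M)ˣ →* (FormalFun n M)ˣ :=
  Units.map (PowerSeries.C (R := SmoothFun n M)).toMonoidHom

/-- The leading coefficient of an invertible formal power series. -/
def leadingUnit : (FormalFun n M)ˣ →* (SmoothFun n M)ˣ :=
  Units.map (PowerSeries.constantCoeff (R := SmoothFun n M)).toMonoidHom

theorem dFun_one : dFun (1 : SmoothFun n M) = 0 := by
  have h := dFun_mul (1 : SmoothFun n M) 1
  rwa [mul_one, one_smul, left_eq_add] at h

/-- Up to an exact form, `D f` only depends on the leading coefficient of `f`. -/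
theorem exists_logD_eq_logD_constUnit_add (f : (FormalFun n M)ˣ) :
    ∃ g : FormalFun n M, logD n M (Additive.ofMul f) =
      logD n M (Additive.ofMul (constUnit (leadingUnit f))) + formalD g := by
  set c := constUnit (leadingUnit f) with hc
  -- The constant coefficient of `c⁻¹ * f` is `1`, so its logarithm is normalised to start with `0`.
  obtain ⟨g, hg0, hg⟩ := exists_euler_eq_units_mul_euler (c⁻¹ * f) 0
  have h0 : PowerSeries.coeff 0 ((c⁻¹ * f : (FormalFun n M)ˣ) : FormalFun n M) = 1 := by
    have h1 : leadingUnit (c⁻¹ * f) = 1 := by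
      have h2 : leadingUnit c = leadingUnit f := by
        ext1
        exact PowerSeries.constantCoeff_C _
      rw [map_mul, map_inv, h2, inv_mul_cancel]
    rw [PowerSeries.coeff_zero_eq_constantCoeff]
    exact congrArg Units.val h1
  have h := (logD_eq_iff (c⁻¹ * f) (formalD g)).2 (formalD_eq_smul_of_euler_eq (by
    rw [h0, hg0, dFun_one, map_zero, smul_zero]) hg)
  refine ⟨g, ?_⟩
  rw [← h, ← map_add, ← ofMul_mul, mul_inv_cancel_left]

theorem coeff_logD_constUnit (f : (SmoothFun n M)ˣ) (k : ℕ) :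
    (logD n M (Additive.ofMul (constUnit f))).coeff k =
      if k = 0 then ((f⁻¹ : (SmoothFun n M)ˣ) : SmoothFun n M) • dFun (f : SmoothFun n M)
      else 0 := by
  rw [logD_apply, FormalSeries.coeff_smul]
  have h1 (k : ℕ) : (formalD (constUnit f : FormalFun n M)).coeff k =
      if k = 0 then dFun (f : SmoothFun n M) else 0 := by
    change dFun (PowerSeries.coeff k (PowerSeries.C (f : SmoothFun n M))) = _
    rw [PowerSeries.coeff_C]
    split_ifs <;> simp
  have h2 (k : ℕ) : PowerSeries.coeff k (((constUnit f)⁻¹ : (FormalFun n M)ˣ) : FormalFun n M) =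
      if k = 0 then ((f⁻¹ : (SmoothFun n M)ˣ) : SmoothFun n M) else 0 := by
    rw [← map_inv]
    exact PowerSeries.coeff_C _ _
  simp only [h1, h2]
  rcases eq_or_ne k 0 with rfl | hk
  · simp
  · rw [if_neg hk]
    refine Finset.sum_eq_zero fun p hp => ?_
    have hp' := Finset.HasAntidiagonal.mem_antidiagonal.1 hp
    rcases eq_or_ne p.1 0 with h | h
    · rw [if_neg (show p.2 ≠ 0 by lia), smul_zero]
    · rw [if_neg h, zero_smul]

/-- `D (C f)` is exact if and only if `f⁻¹ df` is exact. -/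
theorem logD_constUnit_mem_formalExact (f : (SmoothFun n M)ˣ) :
    logD n M (Additive.ofMul (constUnit f)) ∈ formalExact n M ↔
      ∃ g : SmoothFun n M, dFun (f : SmoothFun n M) = (f : SmoothFun n M) • dFun g := by
  have hf (β : OneForm n M) : ((f⁻¹ : (SmoothFun n M)ˣ) : SmoothFun n M) •
      dFun (f : SmoothFun n M) = β ↔ dFun (f : SmoothFun n M) = (f : SmoothFun n M) • β := by
    constructor
    · rintro rfl
      rw [smul_smul, Units.mul_inv, one_smul]
    · intro h
      rw [h, smul_smul, Units.inv_mul, one_smul]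
  constructor
  · rintro ⟨g, hg⟩
    refine ⟨PowerSeries.coeff 0 g, (hf _).1 ?_⟩
    have h := congrArg (fun β => FormalSeries.coeff β 0) hg
    rw [coeff_logD_constUnit] at h
    exact h.symm
  · rintro ⟨g, hg⟩
    refine ⟨PowerSeries.C g, ?_⟩
    ext1
    funext k
    rw [coeff_logD_constUnit, (hf _).2 hg, coeff_formalD, PowerSeries.coeff_C]
    split_ifs <;> simp

end FormalLogarithm

/-! ### Smooth logarithms, closedness and exactness -/

section SmoothLogarithm

open Complex

variable {n : ℕ} {M : Type*} [TopologicalSpace M] [ChartedSpace (EuclideanSpace ℝ (Fin n)) M]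

theorem SmoothFun.units_ne_zero (f : (SmoothFun n M)ˣ) (x : M) : (f : SmoothFun n M) x ≠ 0 := by
  intro h
  have h1 := DFunLike.congr_fun f.mul_inv x
  rw [ContMDiffMap.coe_mul, Pi.mul_apply, h, zero_mul] at h1
  exact zero_ne_one h1

/-- The exponential of a smooth function. -/
def SmoothFun.exp (g : SmoothFun n M) : SmoothFun n M :=
  ⟨fun x => Complex.exp (g x), (contDiff_exp (𝕜 := ℝ)).contMDiff.comp g.contMDiff⟩

/-- The exponential of a smooth function is invertible. -/
def SmoothFun.expUnit (g : SmoothFun n M) : (SmoothFun n M)ˣ where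
  val := SmoothFun.exp g
  inv := SmoothFun.exp (-g)
  val_inv := ContMDiffMap.ext fun x => by
    change Complex.exp (g x) * Complex.exp (-g x) = 1
    rw [← Complex.exp_add, add_neg_cancel, Complex.exp_zero]
  inv_val := ContMDiffMap.ext fun x => by
    change Complex.exp (-g x) * Complex.exp (g x) = 1
    rw [← Complex.exp_add, neg_add_cancel, Complex.exp_zero]

theorem contDiffAt_real_clog {z : ℂ} (hz : z ∈ slitPlane) : ContDiffAt ℝ ∞ Complex.log z :=
  (Complex.contDiffAt_log hz).restrict_scalars ℝ

/-- The local branch of the logarithm of a smooth function that vanishes at `x₀`. -/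
theorem contMDiffAt_log_div {f : M → ℂ} {x₀ x : M} (hf : ContMDiffAt (𝓡 n) 𝓘(ℝ, ℂ) ∞ f x)
    (hx : f x / f x₀ ∈ slitPlane) :
    ContMDiffAt (𝓡 n) 𝓘(ℝ, ℂ) ∞ (fun y => log (f y / f x₀)) x := by
  have h : ContDiffAt ℝ ∞ (fun z : ℂ => log (z / f x₀)) (f x) :=
    (contDiffAt_real_clog hx).comp (f x) (contDiffAt_id.div_const _)
  exact h.contMDiffAt.comp x hf

/-- A logarithm without monodromy of a smooth function is smooth. -/
theorem IsLogCocycle.contMDiff {f l : M → ℂ} (hf : ContMDiff (𝓡 n) 𝓘(ℝ, ℂ) ∞ f)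
    (h : IsLogCocycle f l 0) : ContMDiff (𝓡 n) 𝓘(ℝ, ℂ) ∞ l := by
  intro x
  have : LocallyPathConnectedSpace M :=
    ChartedSpace.locallyPathConnectedSpace (EuclideanSpace ℝ (Fin n)) M
  refine ContMDiffAt.congr_of_eventuallyEq ?_ (h.eventually_eq hf.continuous x)
  have h1 : f x / f x ∈ slitPlane := by simp [h.ne_zero x]
  exact contMDiffAt_const.add (contMDiffAt_log_div (hf x) h1)

theorem mvfderiv_comp_complex {f : M → ℂ} {k : ℂ → ℂ} {k' : ℂ} {x : M}
    (hf : MDifferentiableAt (𝓡 n) 𝓘(ℝ, ℂ) f x) (hk : HasDerivAt k k' (f x)) :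
    mvfderiv (𝓡 n) (fun y => k (f y)) x = k' • mvfderiv (𝓡 n) f x := by
  have h1 := (hk.hasFDerivAt.restrictScalars ℝ).hasMFDerivAt.comp x hf.hasMFDerivAt
  refine h1.mfderiv.trans ?_
  ext v
  exact mul_comm (mvfderiv (𝓡 n) f x v : ℂ) k'

variable [IsManifold (𝓡 n) ∞ M]

theorem dFun_val (f : SmoothFun n M) (x : M) : (dFun f).val x = mvfderiv (𝓡 n) f x := rfl

theorem smul_val (f : SmoothFun n M) (α : OneForm n M) (x : M) :
    (f • α).val x = f x • α.val x := rfl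

theorem add_val (α β : OneForm n M) (x : M) : (α + β).val x = α.val x + β.val x := rfl

theorem dFun_exp (g : SmoothFun n M) : dFun (SmoothFun.exp g) = SmoothFun.exp g • dFun g :=
  OneForm.ext_val fun x =>
    mvfderiv_comp_complex (g.contMDiff.mdifferentiable (by simp) x) (hasDerivAt_exp (g x))

/-- Exact formal one-forms are logarithmic differentials. -/
theorem formalExact_le_range_logD : formalExact n M ≤ (logD n M).range := by
  rintro _ ⟨g, rfl⟩
  obtain ⟨u, hu0, hu⟩ := exists_euler_eq_mul_euler (SmoothFun.exp (PowerSeries.coeff 0 g)) g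
  have hunit : IsUnit u := by
    rw [PowerSeries.isUnit_iff_constantCoeff, ← PowerSeries.coeff_zero_eq_constantCoeff_apply, hu0]
    exact ⟨SmoothFun.expUnit _, rfl⟩
  obtain ⟨v, rfl⟩ := hunit
  refine ⟨Additive.ofMul v, (logD_eq_iff v _).2 (formalD_eq_smul_of_euler_eq ?_ hu)⟩
  rw [hu0, dFun_exp]

/-- A one-form that is locally the differential of a smooth function is closed. -/
theorem OneForm.isClosed_of_locally_exact {α : OneForm n M}
    (h : ∀ x₀, ∃ F : M → ℂ, ∀ᶠ x in 𝓝 x₀, ContMDiffAt (𝓡 n) 𝓘(ℝ, ℂ) ∞ F x ∧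
      α.val x = mvfderiv (𝓡 n) F x) : α.IsClosed := by
  intro p y hy
  obtain ⟨F, hF⟩ := h ((extChartAt (𝓡 n) p).symm y)
  have hsymm : ∀ z ∈ (extChartAt (𝓡 n) p).target,
      ContMDiffAt 𝓘(ℝ, EuclideanSpace ℝ (Fin n)) (𝓡 n) ∞ (extChartAt (𝓡 n) p).symm z :=
    fun z hz => (contMDiffOn_extChartAt_symm p).contMDiffAt (extChartAt_target_mem_nhds' hz)
  have hev : ∀ᶠ z in 𝓝 y, α.inChart p z =
      fderiv ℝ (fun z => F ((extChartAt (𝓡 n) p).symm z)) z := by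
    filter_upwards [(hsymm y hy).continuousAt.eventually hF,
      extChartAt_target_mem_nhds' (I := 𝓡 n) hy] with z hz hzt
    have h1 := (hz.1.mdifferentiableAt (by simp)).hasMFDerivAt.comp z
      ((hsymm z hzt).mdifferentiableAt (by simp)).hasMFDerivAt
    rw [← mfderiv_eq_fderiv]
    refine Eq.trans ?_ h1.mfderiv.symm
    rw [OneForm.inChart, hz.2]
    rfl
  have hcd : ContDiffAt ℝ ∞ (fun z => F ((extChartAt (𝓡 n) p).symm z)) y :=
    contMDiffAt_iff_contDiffAt.1 (hF.self_of_nhds.1.comp y (hsymm y hy))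
  have hev' : (fun z => ContinuousAlternatingMap.ofSubsingleton ℝ (EuclideanSpace ℝ (Fin n)) ℂ
      (0 : Fin 1) (α.inChart p z)) =ᶠ[𝓝 y] extDeriv fun z =>
        ContinuousAlternatingMap.constOfIsEmpty ℝ (EuclideanSpace ℝ (Fin n)) (Fin 0)
          (F ((extChartAt (𝓡 n) p).symm z)) := by
    filter_upwards [hev] with z hz
    rw [hz, extDeriv_constOfIsEmpty]
  -- Near `y` the form in the chart is the exterior derivative of a smooth function, so `d ∘ d = 0`
  -- applies.
  rw [hev'.extDeriv_eq]
  refine extDeriv_extDeriv_apply (r := ∞) ?_ (by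
    rw [minSmoothness_of_isRCLikeNormedField]
    exact WithTop.coe_le_coe.2 (le_top (a := (2 : ℕ∞))))
  exact (ContinuousAlternatingMap.constOfIsEmptyLIE ℝ (EuclideanSpace ℝ (Fin n)) ℂ
    (Fin 0)).contDiff.contDiffAt.comp y hcd

theorem isClosed_dFun (g : SmoothFun n M) : (dFun g).IsClosed :=
  OneForm.isClosed_of_locally_exact fun _ =>
    ⟨g, Filter.Eventually.of_forall fun x => ⟨g.contMDiff x, dFun_val g x⟩⟩

/-- A local primitive is `log (f / f x₀) + g`; dividing by `f x₀` keeps the argument near `1`, away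
from the branch cut. -/
theorem isClosed_logDeriv_add_dFun (f : (SmoothFun n M)ˣ) (g : SmoothFun n M) :
    (((f⁻¹ : (SmoothFun n M)ˣ) : SmoothFun n M) • dFun (f : SmoothFun n M) + dFun g).IsClosed := by
  refine OneForm.isClosed_of_locally_exact fun x₀ =>
    ⟨fun x => log ((f : SmoothFun n M) x / (f : SmoothFun n M) x₀) + g x, ?_⟩
  have hf := (f : SmoothFun n M).contMDiff
  have hne := SmoothFun.units_ne_zero f
  have hU : {x | (f : SmoothFun n M) x / (f : SmoothFun n M) x₀ ∈ slitPlane} ∈ 𝓝 x₀ :=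
    (isOpen_slitPlane.preimage (hf.continuous.div_const _)).mem_nhds (by simp [hne])
  filter_upwards [hU] with x hx
  have h1 := contMDiffAt_log_div (hf x) hx
  refine ⟨h1.add (g.contMDiff x), ?_⟩
  have h2 : HasDerivAt (fun z => log (z / (f : SmoothFun n M) x₀)) ((f : SmoothFun n M) x)⁻¹
      ((f : SmoothFun n M) x) := by
    have h3 := ((hasDerivAt_id ((f : SmoothFun n M) x)).div_const
      ((f : SmoothFun n M) x₀)).clog hx
    refine h3.congr_deriv ?_
    rw [id, one_div, div_eq_mul_inv, div_eq_mul_inv, mul_inv, inv_inv, mul_comm, mul_assoc,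
      mul_inv_cancel₀ (hne x₀), mul_one]
  have h4 : ((f⁻¹ : (SmoothFun n M)ˣ) : SmoothFun n M) x = ((f : SmoothFun n M) x)⁻¹ :=
    eq_inv_of_mul_eq_one_left (DFunLike.congr_fun f.inv_mul x)
  rw [add_val, smul_val, h4]
  have h5 := mvfderiv_add (h1.mdifferentiableAt (by simp))
    (g.contMDiff.mdifferentiable (by simp) x)
  refine Eq.trans ?_ h5.symm
  rw [mvfderiv_comp_complex (hf.mdifferentiable (by simp) x) h2]
  rfl

/-- The logarithmic differential takes values in the closed formal one-forms. -/
theorem range_logD_subset_formalClosed :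
    ((logD n M).range : Set (FormalOneForm n M)) ⊆ formalClosed n M := by
  rintro _ ⟨f, rfl⟩ k
  obtain ⟨g, hg⟩ := exists_logD_eq_logD_constUnit_add f.toMul
  rw [ofMul_toMul] at hg
  rw [hg, FormalSeries.coeff_add, coeff_logD_constUnit, coeff_formalD]
  split_ifs
  · exact isClosed_logDeriv_add_dFun _ _
  · rw [zero_add]
    exact isClosed_dFun _

/-- A smooth function with vanishing differential is locally constant. -/
theorem eventually_eq_of_dFun_eq_zero {h : SmoothFun n M} (hd : dFun h = 0) (x₀ : M) :
    ∀ᶠ x in 𝓝 x₀, h x = h x₀ := by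
  set e := extChartAt (𝓡 n) x₀
  obtain ⟨r, hr, hball⟩ := Metric.mem_nhds_iff.1 (extChartAt_target_mem_nhds (I := 𝓡 n) x₀)
  have hderiv : ∀ z ∈ Metric.ball (e x₀) r, HasFDerivAt (fun z => h (e.symm z))
      (0 : EuclideanSpace ℝ (Fin n) →L[ℝ] ℂ) z := by
    intro z hz
    have h0 : HasMFDerivAt (𝓡 n) 𝓘(ℝ, ℂ) h (e.symm z) 0 := by
      have h1 := (h.contMDiff.mdifferentiable (by simp) (e.symm z)).hasMFDerivAt
      have h2 : (dFun h).val (e.symm z) = 0 := by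
        rw [hd]
        rfl
      rw [dFun_val] at h2
      change HasMFDerivAt (𝓡 n) 𝓘(ℝ, ℂ) h (e.symm z) (mvfderiv (𝓡 n) h (e.symm z)) at h1
      rwa [h2] at h1
    have h3 := h0.comp z ((((contMDiffOn_extChartAt_symm (n := ∞) x₀).contMDiffAt
      (extChartAt_target_mem_nhds' (hball hz))).mdifferentiableAt (by simp)).hasMFDerivAt)
    have h4 := h3.hasFDerivAt
    refine h4.congr_fderiv ?_
    exact ContinuousLinearMap.zero_comp _
  have hconst : ∀ z ∈ Metric.ball (e x₀) r, h (e.symm z) = h (e.symm (e x₀)) := fun z hz =>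
    Metric.isOpen_ball.is_const_of_fderiv_eq_zero (convex_ball _ _).isPreconnected
      (fun z hz => (hderiv z hz).differentiableAt.differentiableWithinAt)
      (fun z hz => (hderiv z hz).fderiv) hz (Metric.mem_ball_self hr)
  filter_upwards [extChartAt_source_mem_nhds (I := 𝓡 n) x₀,
    (continuousAt_extChartAt (I := 𝓡 n) x₀).preimage_mem_nhds (Metric.ball_mem_nhds _ hr)]
    with x hx hxr
  have h1 := hconst _ hxr
  rwa [e.left_inv hx, e.left_inv (mem_extChartAt_source x₀)] at h1

/-- `f⁻¹ df` is exact if and only if the cocycles of `f` are coboundaries. -/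
theorem IsLogCocycle.exists_dFun_eq_iff {f : SmoothFun n M} {l : M → ℂ}
    {φ : SingularSimplex 1 M → ℤ} (h : IsLogCocycle f l φ) :
    (∃ g : SmoothFun n M, dFun f = f • dFun g) ↔ φ ∈ (singularCoboundary M 0).range := by
  constructor
  · rintro ⟨g, hg⟩
    -- `k` is locally constant, so `log k` is continuous even where `k` lies on the branch cut.
    -- Hence `g + log k` is a global continuous logarithm of `f`, whose cocycle is zero.
    set k : SmoothFun n M := f * SmoothFun.exp (-g) with hk
    have hkd : dFun k = 0 := by
      rw [hk, dFun_mul, dFun_exp, hg, map_neg, smul_neg, smul_neg, smul_smul, smul_smul, mul_comm,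
        neg_add_cancel]
    have hk0 (x : M) : k x ≠ 0 := mul_ne_zero (h.ne_zero x) (Complex.exp_ne_zero _)
    have hcont : Continuous fun x => g x + log (k x) := by
      refine g.contMDiff.continuous.add (continuous_iff_continuousAt.2 fun x₀ => ?_)
      refine (continuousAt_const (y := log (k x₀))).congr ?_
      filter_upwards [eventually_eq_of_dFun_eq_zero hkd x₀] with x hx
      rw [hx]
    have hexp (x : M) : Complex.exp (g x + log (k x)) = f x := by
      rw [Complex.exp_add, exp_log (hk0 x)]
      change Complex.exp (g x) * (f x * Complex.exp (-g x)) = f x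
      rw [mul_left_comm, ← Complex.exp_add, add_neg_cancel, Complex.exp_zero, mul_one]
    obtain ⟨c, hc⟩ := h.exists_sub_eq_coboundary (IsLogCocycle.of_continuous hcont hexp)
      f.contMDiff.continuous
    exact ⟨c, (hc.trans (zero_add _)).symm⟩
  · rintro ⟨c, rfl⟩
    -- Absorbing `c` into `l` leaves a logarithm with zero cocycle, which is smooth and serves as
    -- the primitive.
    rw [← zero_add (singularCoboundary M 0 c)] at h
    have h1 := h.add_int
    let L : SmoothFun n M := ⟨_, h1.contMDiff f.contMDiff⟩
    have h2 : f = SmoothFun.exp L := ContMDiffMap.ext fun x => (h1.exp_eq x).symm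
    exact ⟨L, by rw [h2, dFun_exp]⟩

end SmoothLogarithm

/-! ### Realization of cocycles by a partition of unity -/

section Realization

open Complex

variable {n : ℕ} {M : Type*} [TopologicalSpace M] [ChartedSpace (EuclideanSpace ℝ (Fin n)) M]

/-- Two primitives of a cocycle differ by a locally constant function. -/
theorem eventually_sub_eq_of_primitives [LocallyPathConnectedSpace M]
    {φ : SingularSimplex 1 M → ℤ} {U V : Set M} (hU : IsOpen U) (hV : IsOpen V) {a b : M → ℤ}
    (ha : ∀ σ : SingularSimplex 1 M, (∀ t, σ t ∈ U) →
      φ σ = a (σ (simplexVertex 1)) - a (σ (simplexVertex 0)))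
    (hb : ∀ σ : SingularSimplex 1 M, (∀ t, σ t ∈ V) →
      φ σ = b (σ (simplexVertex 1)) - b (σ (simplexVertex 0)))
    {x₀ : M} (hxU : x₀ ∈ U) (hxV : x₀ ∈ V) : ∀ᶠ x in 𝓝 x₀, a x - b x = a x₀ - b x₀ := by
  obtain ⟨W, ⟨hW, hWc⟩, hWU⟩ :=
    (path_connected_basis x₀).mem_iff.1 ((hU.inter hV).mem_nhds ⟨hxU, hxV⟩)
  filter_upwards [hW] with x hx
  obtain ⟨γ, hγ⟩ := hWc.joinedIn x₀ (mem_of_mem_nhds hW) x hx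
  have h1 := ha γ.toSimplex fun t => (hWU (hγ _)).1
  have h2 := hb γ.toSimplex fun t => (hWU (hγ _)).2
  rw [Path.toSimplex_zero, Path.toSimplex_one] at h1 h2
  lia

variable [IsManifold (𝓡 n) ∞ M]

/-- Every integral singular `1`-cocycle is the cocycle of a nowhere vanishing smooth function. -/
theorem exists_units_isLogCocycle [T2Space M] [SecondCountableTopology M]
    {φ : SingularSimplex 1 M → ℤ} (hφ : singularCoboundary M 1 φ = 0) :
    ∃ (f : (SmoothFun n M)ˣ) (l : M → ℂ), IsLogCocycle (f : SmoothFun n M) l φ := by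
  have : LocallyPathConnectedSpace M :=
    ChartedSpace.locallyPathConnectedSpace (EuclideanSpace ℝ (Fin n)) M
  have : LocallyCompactSpace M := ChartedSpace.locallyCompactSpace (EuclideanSpace ℝ (Fin n)) M
  have hball (p : M) : ∃ r > 0, Metric.ball (chartAt (EuclideanSpace ℝ (Fin n)) p p) r ⊆
      (chartAt (EuclideanSpace ℝ (Fin n)) p).target :=
    Metric.mem_nhds_iff.1 (chart_target_mem_nhds _ p)
  choose r hr hrt using hball
  choose c hc using fun p => exists_primitive_chartBall hφ _ _ (hrt p)
  set U : M → Set M := fun p => chartBall (chartAt (EuclideanSpace ℝ (Fin n)) p)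
    (chartAt (EuclideanSpace ℝ (Fin n)) p p) (r p) with hUdef
  have hUo (p : M) : IsOpen (U p) := isOpen_chartBall _ _ _
  have hUp (p : M) : p ∈ U p := ⟨mem_chart_source _ p, Metric.mem_ball_self (hr p)⟩
  obtain ⟨ρ, hρ⟩ := SmoothPartitionOfUnity.exists_isSubordinate (𝓡 n) isClosed_univ U hUo
    fun x _ => Set.mem_iUnion.2 ⟨x, hUp x⟩
  have hsum (x : M) : ∑ᶠ i, ρ i x = 1 := ρ.sum_eq_one (Set.mem_univ x)
  have hfin (x : M) : (Function.support fun i => ρ i x).Finite := ρ.locallyFinite.point_finite x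
  -- The sign ensures that `h + c_j = ∑ ρ_i (c_j - c_i)` on `U_j`. The coefficients are locally
  -- constant near the support of `ρ_i`, so this sum is smooth although `h` is not.
  let h : M → ℝ := fun x => -∑ᶠ i, ρ i x • (c i x : ℝ)
  have hloc (j x : M) : h x + c j x = ∑ᶠ i, ρ i x • ((c j x - c i x : ℤ) : ℝ) := by
    have h1 : (c j x : ℝ) = ∑ᶠ i, ρ i x • (c j x : ℝ) := by
      rw [← finsum_smul, hsum, one_smul]
    have h2 : (fun i => ρ i x • ((c j x - c i x : ℤ) : ℝ)) = fun i =>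
        ρ i x • (c j x : ℝ) - ρ i x • (c i x : ℝ) := by
      funext i
      push_cast
      rw [smul_sub]
    rw [h2, finsum_sub_distrib ((hfin x).subset fun i hi hi' => hi (by simp [hi']))
      ((hfin x).subset fun i hi hi' => hi (by simp [hi'])), ← h1]
    ring
  have hsmooth (j x : M) (hx : x ∈ U j) :
      ContMDiffAt (𝓡 n) 𝓘(ℝ, ℝ) ∞ (fun x => h x + c j x) x := by
    simp only [hloc]
    refine ρ.contMDiffAt_finsum fun i hi => ?_
    refine (contMDiffAt_const (c := ((c j x - c i x : ℤ) : ℝ))).congr_of_eventuallyEq ?_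
    filter_upwards [eventually_sub_eq_of_primitives (hUo j) (hUo i) (hc j) (hc i) hx (hρ i hi)]
      with y hy
    rw [hy]
  have hexp (j x : M) : exp (2 * Real.pi * I * (h x : ℂ)) =
      exp (2 * Real.pi * I * ((h x + c j x : ℝ) : ℂ)) := by
    push_cast
    rw [mul_add, exp_add, mul_comm _ (c j x : ℂ), exp_int_mul_two_pi_mul_I, mul_one]
  have hF : ContMDiff (𝓡 n) 𝓘(ℝ, ℂ) ∞ fun x => exp (2 * Real.pi * I * (h x : ℂ)) := by
    intro x
    have h1 : ContDiff ℝ ∞ fun s : ℝ => exp (2 * Real.pi * I * (s : ℂ)) :=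
      (contDiff_const.mul Complex.ofRealCLM.contDiff).cexp
    simp only [hexp x]
    exact h1.contMDiff.contMDiffAt.comp x (hsmooth x x (hUp x))
  obtain ⟨ψ, hψ, hlog⟩ := exists_isLogCocycle hF.continuous
    (l := fun x => 2 * Real.pi * I * (h x : ℂ)) fun x => rfl
  -- With this choice of `l` the cocycles agree as cochains, not only up to a coboundary: inside
  -- `U_j` the function `2πi (h + c_j)` is a continuous logarithm, and its increment exceeds that of
  -- `l` by `2πi` times that of `c_j`.
  have hψφ : ψ - φ = 0 := by
    refine cocycle_eq_zero_of_cover (by rw [map_sub, hψ, hφ, sub_zero]) hUo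
      (fun x => ⟨x, hUp x⟩) fun j σ hσ => ?_
    have hcont : Continuous fun t => h (σ t) + c j (σ t) :=
      continuous_iff_continuousAt.2 fun t =>
        ContinuousAt.comp (hsmooth j _ (hσ t)).continuousAt σ.continuous.continuousAt
    have h1 := hlog.lift_sub_lift σ
      ⟨fun t => 2 * Real.pi * I * ((h (σ t) + c j (σ t) : ℝ) : ℂ), by fun_prop⟩
      fun t => (hexp j _).symm
    rw [Pi.sub_apply, hc j σ hσ, sub_eq_zero]
    have h2 : (2 * Real.pi * I) * (ψ σ : ℂ) = (2 * Real.pi * I) *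
        ((c j (σ (simplexVertex 1)) - c j (σ (simplexVertex 0)) : ℤ) : ℂ) := by
      simp only [ContinuousMap.coe_mk] at h1
      push_cast at h1 ⊢
      linear_combination -h1
    exact_mod_cast mul_left_cancel₀ two_pi_I_ne_zero h2
  rw [sub_eq_zero.1 hψφ] at hlog
  have hinv : ContMDiff (𝓡 n) 𝓘(ℝ, ℂ) ∞ fun x => exp (-(2 * Real.pi * I * (h x : ℂ))) := by
    simp only [exp_neg]
    intro x
    exact ContMDiffAt.comp x (g := fun z : ℂ => z⁻¹)
      (contDiffAt_inv ℝ (exp_ne_zero _)).contMDiffAt (hF x)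
  refine ⟨⟨⟨_, hF⟩, ⟨_, hinv⟩, ?_, ?_⟩, _, hlog⟩
  · refine ContMDiffMap.ext fun x => ?_
    change exp (2 * Real.pi * I * (h x : ℂ)) * exp (-(2 * Real.pi * I * (h x : ℂ))) = 1
    rw [← exp_add, add_neg_cancel, exp_zero]
  · refine ContMDiffMap.ext fun x => ?_
    change exp (-(2 * Real.pi * I * (h x : ℂ))) * exp (2 * Real.pi * I * (h x : ℂ)) = 1
    rw [← exp_add, neg_add_cancel, exp_zero]

end Realization

/-! ### The group of pairs and the isomorphism -/

section Comparison

variable (n : ℕ) (M : Type*) [TopologicalSpace M] [ChartedSpace (EuclideanSpace ℝ (Fin n)) M]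

/-- Pairs of a nowhere vanishing smooth function and a singular cocycle of one of its
logarithms. -/
def logCocyclePairs :
    AddSubgroup (Additive (SmoothFun n M)ˣ × (singularCoboundary M 1).ker) where
  carrier := {p | ∃ l : M → ℂ, IsLogCocycle (p.1.toMul : SmoothFun n M) l p.2.1}
  zero_mem' := ⟨0, IsLogCocycle.of_continuous continuous_const fun _ => Complex.exp_zero⟩
  add_mem' := by
    rintro p q ⟨l, hl⟩ ⟨l', hl'⟩
    exact ⟨l + l', hl.mul hl' (p.1.toMul : SmoothFun n M).contMDiff.continuous⟩
  neg_mem' := by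
    rintro p ⟨l, hl⟩
    refine ⟨-l, ?_⟩
    have h : ⇑((p.1.toMul⁻¹ : (SmoothFun n M)ˣ) : SmoothFun n M) =
        (⇑(p.1.toMul : SmoothFun n M))⁻¹ := by
      funext x
      exact eq_inv_of_mul_eq_one_left (DFunLike.congr_fun p.1.toMul.inv_mul x)
    change IsLogCocycle ⇑((p.1.toMul⁻¹ : (SmoothFun n M)ˣ) : SmoothFun n M) (-l) (-p.2.1)
    rw [h]
    exact hl.inv

/-- The projection of `logCocyclePairs` to the first singular cohomology group. -/
def logCocyclePairs.toSingularH1 : logCocyclePairs n M →+ SingularH1 M :=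
  (QuotientAddGroup.mk' _).comp
    ((AddMonoidHom.snd _ _).comp (logCocyclePairs n M).subtype)

variable [IsManifold (𝓡 n) ∞ M]

/-- The projection of `logCocyclePairs` to the logarithmic differentials modulo exact forms. -/
def logCocyclePairs.toLogDQuotient : logCocyclePairs n M →+
    (logD n M).range ⧸ (formalExact n M).addSubgroupOf (logD n M).range :=
  (QuotientAddGroup.mk' _).comp ((logD n M).rangeRestrict.comp
    ((MonoidHom.toAdditive (constUnit (n := n) (M := M))).comp
      ((AddMonoidHom.fst _ _).comp (logCocyclePairs n M).subtype)))

theorem logCocyclePairs.ker_toLogDQuotient_eq :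
    (toLogDQuotient n M).ker = (toSingularH1 n M).ker := by
  ext ⟨p, l, hl⟩
  rw [AddMonoidHom.mem_ker, AddMonoidHom.mem_ker]
  -- Both kernels express one condition on the pair: exactness of `f⁻¹ df` on one side, `φ` being a
  -- coboundary on the other.
  exact (QuotientAddGroup.eq_zero_iff _).trans (AddSubgroup.mem_addSubgroupOf.trans
    ((logD_constUnit_mem_formalExact p.1.toMul).trans (hl.exists_dFun_eq_iff.trans
      (AddSubgroup.mem_addSubgroupOf.symm.trans (QuotientAddGroup.eq_zero_iff _).symm))))

theorem logCocyclePairs.toLogDQuotient_surjective :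
    Function.Surjective (toLogDQuotient n M) := by
  intro q
  obtain ⟨⟨_, f, rfl⟩, rfl⟩ := QuotientAddGroup.mk_surjective q
  obtain ⟨g, hg⟩ := exists_logD_eq_logD_constUnit_add f.toMul
  set u := leadingUnit f.toMul
  obtain ⟨φ, hφ, h⟩ := exists_isLogCocycle (u : SmoothFun n M).contMDiff.continuous
    fun x => Complex.exp_log (SmoothFun.units_ne_zero u x)
  refine ⟨⟨(Additive.ofMul u, ⟨φ, hφ⟩), _, h⟩, QuotientAddGroup.eq.2 ?_⟩
  refine AddSubgroup.mem_addSubgroupOf.2 ⟨g, ?_⟩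
  rw [ofMul_toMul] at hg
  change formalD g = -logD n M (Additive.ofMul (constUnit u)) + logD n M f
  rw [hg, neg_add_cancel_left]

theorem logCocyclePairs.toSingularH1_surjective [T2Space M] [SecondCountableTopology M] :
    Function.Surjective (toSingularH1 n M) := by
  intro q
  obtain ⟨⟨φ, hφ⟩, rfl⟩ := QuotientAddGroup.mk_surjective q
  obtain ⟨f, l, h⟩ := exists_units_isLogCocycle (n := n) hφ
  exact ⟨⟨(Additive.ofMul f, ⟨φ, hφ⟩), l, h⟩, rfl⟩

end Comparison

end

theorem mainTheorem11 (n : ℕ) (M : Type*) [TopologicalSpace M] [T2Space M]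
    [SecondCountableTopology M] [ChartedSpace (EuclideanSpace ℝ (Fin n)) M]
    [IsManifold (𝓡 n) ∞ M] :
    ((logD n M).range : Set (FormalOneForm n M)) ⊆ formalClosed n M ∧
    formalExact n M ≤ (logD n M).range ∧
    Nonempty (((logD n M).range ⧸ (formalExact n M).addSubgroupOf (logD n M).range) ≃+
      SingularH1 M) := by
  refine ⟨range_logD_subset_formalClosed, formalExact_le_range_logD, ⟨?_⟩⟩
  -- Both groups are the quotient of the group of pairs by the common kernel.
  exact (QuotientAddGroup.quotientKerEquivOfSurjective _
    (logCocyclePairs.toLogDQuotient_surjective n M)).symm.trans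
    ((QuotientAddGroup.quotientAddEquivOfEq (logCocyclePairs.ker_toLogDQuotient_eq n M)).trans
      (QuotientAddGroup.quotientKerEquivOfSurjective _
        (logCocyclePairs.toSingularH1_surjective n M)))
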